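/- Let ${\mathbb K}$ be a field and let $E=(E^0,E^1,s,r)$ be an arbitrary directed graph. Its Leavitt path algebra $L_{\mathbb K}(E)$ is the associative (in general non-unital) ${\mathbb K}$-algebra generated by $E^0\cup E^1\cup\{e^*\mid e\in E^1\}$ subject to the relations: $vw=\delta_{v,w}v$ for $v,w\in E^0$; $s(e)e=er(e)=e$ and $r(e)e^*=e^*s(e)=e^*$ for $e\in E^1$; $e^*f=\delta_{e,f}\,r(e)$ for $e,f\in E^1$; and $v=\sum_{s(e)=v}ee^*$ for every $v\in E^0$ that emits a finite, nonzero number of edges. The centroid $\mathcal C(A)$ of a ${\mathbb K}$-algebra $A$ is the ${\mathbb K}$-algebra, under composition, of all ${\mathbb K}$-linear maps $\tau\colon A\to A$ (called centralizers) with $\tau(xy)=\tau(x)y=x\tau(y)$ for all $x,y\in A$. If $L_{\mathbb K}(E)$ is simple, then $\mathcal C(L_{\mathbb K}(E))$ is isomorphic to ${\mathbb K}$ as a ${\mathbb K}$-algebra; that is, every centralizer of $L_{\mathbb K}(E)$ is of the form $x\mapsto kx$ for some $k\in{\mathbb K}$. -/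

import Mathlib

universe u v w

/-- A directed graph with set of vertices `V` and set of edges `E`, given by its source and range
maps. Loops and multiple edges are allowed and there is no restriction on cardinalities. -/
structure DirectedGraph (V : Type u) (E : Type v) where
  /-- The source of an edge. -/
  s : E → V
  /-- The range of an edge. -/
  r : E → V

namespace DirectedGraph

/-- The generators of the Leavitt path algebra: vertices, real edges and ghost edges. -/
inductive Generator (V : Type u) (E : Type v) : Type (max u v)
  | vertex (a : V) : Generator V E
  | edge (e : E) : Generator V E
  | ghost (e : E) : Generator V E

/-- The free associative (non-unital) `R`-algebra on the vertices, real edges and ghost edges: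
the semigroup algebra of the free semigroup of nonempty words. -/
abbrev FreeAlg (R : Type w) [CommRing R] (V : Type u) (E : Type v) : Type (max u v w) :=
  MonoidAlgebra R (FreeSemigroup (Generator V E))

section Generators

variable (R : Type w) [CommRing R] {V : Type u} {E : Type v}

/-- A generator, as an element of the free associative algebra. -/
noncomputable def gen (x : Generator V E) : FreeAlg R V E :=
  MonoidAlgebra.single (FreeSemigroup.of x) 1

/-- The vertex `a`, as an element of the free associative algebra. -/
noncomputable def vert (a : V) : FreeAlg R V E := gen R (Generator.vertex a)

/-- The real edge `e`, as an element of the free associative algebra. -/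
noncomputable def edge (e : E) : FreeAlg R V E := gen R (Generator.edge e)

/-- The ghost edge `e*`, as an element of the free associative algebra. -/
noncomputable def ghost (e : E) : FreeAlg R V E := gen R (Generator.ghost e)

end Generators

variable {V : Type u} {E : Type v}

/-- The defining relations of the Leavitt path algebra: `Rel G R x y` says that `x = y` is one of
the relations (V), (E1), (E2), (CK1), (CK2). -/
inductive Rel (G : DirectedGraph V E) (R : Type w) [CommRing R] :
    FreeAlg R V E → FreeAlg R V E → Prop
  /-- (V) `a a = a` for every vertex `a`. -/
  | vert_mul_self (a : V) : Rel G R (vert R a * vert R a) (vert R a)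
  /-- (V) `a b = 0` for distinct vertices `a`, `b`. -/
  | vert_mul_of_ne (a b : V) (h : a ≠ b) : Rel G R (vert R a * vert R b) 0
  /-- (E1) `s(e) e = e`. -/
  | source_mul_edge (e : E) : Rel G R (vert R (G.s e) * edge R e) (edge R e)
  /-- (E1) `e r(e) = e`. -/
  | edge_mul_range (e : E) : Rel G R (edge R e * vert R (G.r e)) (edge R e)
  /-- (E2) `r(e) e* = e*`. -/
  | range_mul_ghost (e : E) : Rel G R (vert R (G.r e) * ghost R e) (ghost R e)
  /-- (E2) `e* s(e) = e*`. -/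
  | ghost_mul_source (e : E) : Rel G R (ghost R e * vert R (G.s e)) (ghost R e)
  /-- (CK1) `e* e = r(e)`. -/
  | ghost_mul_edge_self (e : E) : Rel G R (ghost R e * edge R e) (vert R (G.r e))
  /-- (CK1) `e* f = 0` for distinct edges `e`, `f`. -/
  | ghost_mul_edge_of_ne (e f : E) (h : e ≠ f) : Rel G R (ghost R e * edge R f) 0
  /-- (CK2) `a = ∑ e e*`, the sum over the edges `e` with source `a`, for every regular vertex `a`,
  that is, a vertex which emits finitely many edges and at least one. -/
  | cuntz_krieger (a : V) (hfin : {e : E | G.s e = a}.Finite) (hne : {e : E | G.s e = a}.Nonempty) :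
      Rel G R (vert R a) (∑ e ∈ hfin.toFinset, edge R e * ghost R e)

/-- The smallest congruence of `R`-algebras that contains the defining relations. The scalar
multiples of the relations are included because the free algebra has no unit. -/
noncomputable def leavittCon (G : DirectedGraph V E) (R : Type w) [CommRing R] : RingCon (FreeAlg R V E) :=
  ringConGen fun x y => ∃ (k : R) (x' y' : FreeAlg R V E), G.Rel R x' y' ∧ x = k • x' ∧ y = k • y'

theorem leavittCon_smul (G : DirectedGraph V E) (R : Type w) [CommRing R] (k : R)
    {x y : FreeAlg R V E} (h : G.leavittCon R x y) : G.leavittCon R (k • x) (k • y) := by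
  have key : ∀ {x y : FreeAlg R V E}, RingConGen.Rel (fun x y => ∃ (k : R) (x' y' : FreeAlg R V E),
      G.Rel R x' y' ∧ x = k • x' ∧ y = k • y') x y → G.leavittCon R (k • x) (k • y) := by
    intro x y h
    induction h with
    | of x y h =>
      obtain ⟨c, x', y', h, rfl, rfl⟩ := h
      exact RingConGen.Rel.of _ _ ⟨k * c, x', y', h, (mul_smul k c x').symm, (mul_smul k c y').symm⟩
    | refl x => exact (G.leavittCon R).refl _
    | symm _ ih => exact (G.leavittCon R).symm ih
    | trans _ _ ih₁ ih₂ => exact (G.leavittCon R).trans ih₁ ih₂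
    | add _ _ ih₁ ih₂ =>
      rw [smul_add, smul_add]
      exact (G.leavittCon R).add ih₁ ih₂
    | mul _ h₂ ih₁ _ =>
      rw [← smul_mul_assoc, ← smul_mul_assoc]
      exact (G.leavittCon R).mul ih₁ h₂
  exact key h

/-- The Leavitt path algebra of the directed graph `G` with coefficients in `R`: the associative,
in general non-unital, `R`-algebra generated by the vertices, the real edges and the ghost edges,
subject to the relations (V), (E1), (E2), (CK1), (CK2). -/
def LeavittPathAlgebra (G : DirectedGraph V E) (R : Type w) [CommRing R] : Type (max u v w) :=
  (G.leavittCon R).Quotient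

namespace LeavittPathAlgebra

variable (G : DirectedGraph V E) (R : Type w) [CommRing R]

noncomputable instance : NonUnitalRing (G.LeavittPathAlgebra R) :=
  inferInstanceAs (NonUnitalRing (G.leavittCon R).Quotient)

/-- The quotient map from the free associative algebra to the Leavitt path algebra. -/
noncomputable def mk (x : FreeAlg R V E) : G.LeavittPathAlgebra R := RingCon.toQuotient (c := G.leavittCon R) x

theorem mk_surjective : Function.Surjective (mk G R) := Quotient.mk''_surjective

theorem mk_add (x y : FreeAlg R V E) : mk G R (x + y) = mk G R x + mk G R y := rfl

theorem mk_mul (x y : FreeAlg R V E) : mk G R (x * y) = mk G R x * mk G R y := rfl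

theorem mk_zero : mk G R (0 : FreeAlg R V E) = 0 := rfl

noncomputable instance : SMul R (G.LeavittPathAlgebra R) where
  smul k := Quotient.map' (k • ·) fun _ _ h => leavittCon_smul G R k h

theorem mk_smul (k : R) (x : FreeAlg R V E) : mk G R (k • x) = k • mk G R x := rfl

noncomputable instance : Module R (G.LeavittPathAlgebra R) where
  one_smul a := by
    obtain ⟨x, rfl⟩ := mk_surjective G R a
    rw [← mk_smul, one_smul]
  mul_smul k l a := by
    obtain ⟨x, rfl⟩ := mk_surjective G R a
    rw [← mk_smul, ← mk_smul, ← mk_smul, mul_smul]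
  smul_zero k := by
    rw [← mk_zero, ← mk_smul, smul_zero]
  smul_add k a b := by
    obtain ⟨x, rfl⟩ := mk_surjective G R a
    obtain ⟨y, rfl⟩ := mk_surjective G R b
    rw [← mk_add, ← mk_smul, ← mk_smul, ← mk_smul, ← mk_add, smul_add]
  add_smul k l a := by
    obtain ⟨x, rfl⟩ := mk_surjective G R a
    rw [← mk_smul, ← mk_smul, ← mk_smul, ← mk_add, add_smul]
  zero_smul a := by
    obtain ⟨x, rfl⟩ := mk_surjective G R a
    rw [← mk_smul, zero_smul, mk_zero]

instance : IsScalarTower R (G.LeavittPathAlgebra R) (G.LeavittPathAlgebra R) where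
  smul_assoc k a b := by
    obtain ⟨x, rfl⟩ := mk_surjective G R a
    obtain ⟨y, rfl⟩ := mk_surjective G R b
    rw [smul_eq_mul, smul_eq_mul, ← mk_smul, ← mk_mul, ← mk_mul, ← mk_smul, smul_mul_assoc]

instance : SMulCommClass R (G.LeavittPathAlgebra R) (G.LeavittPathAlgebra R) where
  smul_comm k a b := by
    obtain ⟨x, rfl⟩ := mk_surjective G R a
    obtain ⟨y, rfl⟩ := mk_surjective G R b
    rw [smul_eq_mul, smul_eq_mul, ← mk_smul, ← mk_mul, ← mk_mul, ← mk_smul, mul_smul_comm]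

end LeavittPathAlgebra

end DirectedGraph

/-- The centroid of a (possibly non-unital) `K`-algebra `A`: the `K`-algebra, under composition, of
all `K`-linear maps `τ : A → A` with `τ (x y) = τ(x) y = x τ(y)` for all `x`, `y`. Its elements are
the centralizers of `A`. -/
def centroid (K : Type w) (A : Type u) [CommRing K] [NonUnitalRing A] [Module K A]
    [IsScalarTower K A A] [SMulCommClass K A A] : Subalgebra K (Module.End K A) where
  carrier := {τ | ∀ x y : A, τ (x * y) = τ x * y ∧ τ (x * y) = x * τ y}
  mul_mem' {σ τ} hσ hτ x y := by
    constructor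
    · rw [Module.End.mul_apply, Module.End.mul_apply, (hτ x y).1, (hσ _ y).1]
    · rw [Module.End.mul_apply, Module.End.mul_apply, (hτ x y).2, (hσ x _).2]
  add_mem' {σ τ} hσ hτ x y := by
    constructor
    · rw [LinearMap.add_apply, LinearMap.add_apply, (hσ x y).1, (hτ x y).1, add_mul]
    · rw [LinearMap.add_apply, LinearMap.add_apply, (hσ x y).2, (hτ x y).2, mul_add]
  algebraMap_mem' k x y := by
    rw [Module.algebraMap_end_apply, Module.algebraMap_end_apply, Module.algebraMap_end_apply]
    exact ⟨(smul_mul_assoc k x y).symm, (mul_smul_comm k x y).symm⟩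

/-! For a centralizer τ and a vertex a, the element τ(a) is central in the corner at a. Simplicity
makes each nonzero central element of a corner invertible there (`exists_mul_eq_of_simple`). Grade
the algebra by real minus ghost edges. If a central z had a nonzero component c of degree n ≠ 0,
then c and a + c would both be invertible in the corner; but an inverse of a + c would be a
geometric series in c or in its inverse, with infinitely many nonzero components
(`component_eq_zero_of_simple`). So τ(a) has degree zero and is a combination of monomials with
equally many real and ghost edges.

For an edge e, e* τ(s(e)) e = τ(r(e)), and this conjugation shortens such monomials. Following edges
from a nonzero vertex therefore reaches a vertex b ≠ 0 with τ(b) = kb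
(`exists_centralizer_vtx_eq_smul`). Finally {x | τ(x) = kx} is a two-sided ideal containing b, hence
everything. -/

namespace DirectedGraph

namespace LeavittPathAlgebra

/-! ### Relations among the generators in the quotient -/

section Generators

variable {V : Type u} {E : Type v} (G : DirectedGraph V E) (R : Type w) [CommRing R]

/-- A vertex, as an element of the Leavitt path algebra. -/
noncomputable def vtx (a : V) : G.LeavittPathAlgebra R := mk G R (vert R a)

/-- A real edge, as an element of the Leavitt path algebra. -/
noncomputable def arr (e : E) : G.LeavittPathAlgebra R := mk G R (edge R e)

/-- A ghost edge, as an element of the Leavitt path algebra. -/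
noncomputable def gho (e : E) : G.LeavittPathAlgebra R := mk G R (ghost R e)

theorem mk_eq_of_rel {x y : FreeAlg R V E} (h : G.Rel R x y) : mk G R x = mk G R y :=
  (RingCon.eq _).2 (RingConGen.Rel.of _ _ ⟨1, x, y, h, (one_smul _ _).symm, (one_smul _ _).symm⟩)

theorem vtx_mul_self (a : V) : vtx G R a * vtx G R a = vtx G R a :=
  mk_eq_of_rel G R (Rel.vert_mul_self a)

theorem vtx_mul_of_ne {a b : V} (h : a ≠ b) : vtx G R a * vtx G R b = 0 :=
  mk_eq_of_rel G R (Rel.vert_mul_of_ne a b h)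

theorem vtx_source_mul_arr (e : E) : vtx G R (G.s e) * arr G R e = arr G R e :=
  mk_eq_of_rel G R (Rel.source_mul_edge e)

theorem arr_mul_vtx_range (e : E) : arr G R e * vtx G R (G.r e) = arr G R e :=
  mk_eq_of_rel G R (Rel.edge_mul_range e)

theorem vtx_range_mul_gho (e : E) : vtx G R (G.r e) * gho G R e = gho G R e :=
  mk_eq_of_rel G R (Rel.range_mul_ghost e)

theorem gho_mul_vtx_source (e : E) : gho G R e * vtx G R (G.s e) = gho G R e :=
  mk_eq_of_rel G R (Rel.ghost_mul_source e)

theorem gho_mul_arr_self (e : E) : gho G R e * arr G R e = vtx G R (G.r e) :=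
  mk_eq_of_rel G R (Rel.ghost_mul_edge_self e)

theorem gho_mul_arr_of_ne {e f : E} (h : e ≠ f) : gho G R e * arr G R f = 0 :=
  mk_eq_of_rel G R (Rel.ghost_mul_edge_of_ne e f h)

theorem vtx_mul_arr_of_ne {a : V} {e : E} (h : a ≠ G.s e) : vtx G R a * arr G R e = 0 := by
  rw [← vtx_source_mul_arr, ← mul_assoc, vtx_mul_of_ne G R h, zero_mul]

theorem gho_mul_vtx_of_ne {a : V} {e : E} (h : G.s e ≠ a) : gho G R e * vtx G R a = 0 := by
  rw [← gho_mul_vtx_source, mul_assoc, vtx_mul_of_ne G R h, mul_zero]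

end Generators

/-! ### Spanning by monomials -/

section Monomials

variable {V : Type u} {E : Type v} (G : DirectedGraph V E) (R : Type w) [CommRing R]

/-- `IsMonomial G R m n x` says that `x = e₁ ⋯ eₘ a f₁* ⋯ fₙ*` for edges `eᵢ`, `fⱼ` and a
vertex `a`. The edges need not be composable, in which case `x = 0`. -/
inductive IsMonomial : ℕ → ℕ → G.LeavittPathAlgebra R → Prop
  | vertex (a : V) : IsMonomial 0 0 (vtx G R a)
  | arr_mul (e : E) {m n : ℕ} {x : G.LeavittPathAlgebra R} (h : IsMonomial m n x) :
      IsMonomial (m + 1) n (arr G R e * x)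
  | mul_gho (e : E) {n : ℕ} {x : G.LeavittPathAlgebra R} (h : IsMonomial 0 n x) :
      IsMonomial 0 (n + 1) (x * gho G R e)

variable {G R} {m n : ℕ} {x : G.LeavittPathAlgebra R}

theorem IsMonomial.vtx_mul (h : IsMonomial G R m n x) (a : V) :
    vtx G R a * x = x ∨ vtx G R a * x = 0 := by
  induction h with
  | vertex b =>
    by_cases hab : a = b
    · exact Or.inl (by rw [hab, vtx_mul_self])
    · exact Or.inr (vtx_mul_of_ne G R hab)
  | arr_mul e h ih =>
    rw [← mul_assoc]
    by_cases hae : a = G.s e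
    · exact Or.inl (by rw [hae, vtx_source_mul_arr])
    · exact Or.inr (by rw [vtx_mul_arr_of_ne G R hae, zero_mul])
  | mul_gho e h ih =>
    rw [← mul_assoc]
    rcases ih with ih | ih
    · exact Or.inl (by rw [ih])
    · exact Or.inr (by rw [ih, zero_mul])

theorem IsMonomial.mul_vtx (h : IsMonomial G R m n x) (a : V) :
    x * vtx G R a = x ∨ x * vtx G R a = 0 := by
  induction h with
  | vertex b =>
    by_cases hab : b = a
    · exact Or.inl (by rw [hab, vtx_mul_self])
    · exact Or.inr (vtx_mul_of_ne G R hab)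
  | arr_mul e h ih =>
    rw [mul_assoc]
    rcases ih with ih | ih
    · exact Or.inl (by rw [ih])
    · exact Or.inr (by rw [ih, mul_zero])
  | mul_gho e h ih =>
    rw [mul_assoc]
    by_cases hae : G.s e = a
    · exact Or.inl (by rw [← hae, gho_mul_vtx_source])
    · exact Or.inr (by rw [gho_mul_vtx_of_ne G R hae, mul_zero])

theorem IsMonomial.gho_mul_succ (h : IsMonomial G R (m + 1) n x) (e : E) :
    IsMonomial G R m n (gho G R e * x) ∨ gho G R e * x = 0 := by
  obtain _ | ⟨f, h⟩ | _ := h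
  rw [← mul_assoc]
  by_cases hef : e = f
  · rw [hef, gho_mul_arr_self]
    rcases h.vtx_mul (G.r f) with h' | h'
    · exact Or.inl (by rwa [h'])
    · exact Or.inr h'
  · exact Or.inr (by rw [gho_mul_arr_of_ne G R hef, zero_mul])

/-- With no real edge to cancel, e* is absorbed: e* s(e) = r(e) e* puts the vertex back in front,
and the remaining ghost edges follow. The equation `hm` keeps the index `m` a variable for the
induction. -/
theorem IsMonomial.gho_mul_zero (h : IsMonomial G R m n x) (hm : m = 0) (e : E) :
    IsMonomial G R 0 (n + 1) (gho G R e * x) ∨ gho G R e * x = 0 := by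
  induction h with
  | vertex a =>
    by_cases hea : G.s e = a
    · refine Or.inl ?_
      rw [← hea, gho_mul_vtx_source, ← vtx_range_mul_gho]
      exact .mul_gho e (.vertex _)
    · exact Or.inr (gho_mul_vtx_of_ne G R hea)
  | arr_mul => omega
  | mul_gho f h ih =>
    rw [← mul_assoc]
    rcases ih hm with ih | ih
    · exact Or.inl (.mul_gho f ih)
    · exact Or.inr (by rw [ih, zero_mul])

theorem IsMonomial.mul_arr (h : IsMonomial G R m (n + 1) x) (e : E) :
    IsMonomial G R m n (x * arr G R e) ∨ x * arr G R e = 0 := by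
  generalize hn : n + 1 = n' at h
  induction h with
  | vertex => omega
  | arr_mul f h ih =>
    rw [mul_assoc]
    rcases ih hn with ih | ih
    · exact Or.inl (.arr_mul f ih)
    · exact Or.inr (by rw [ih, mul_zero])
  | mul_gho f h ih =>
    obtain rfl := Nat.succ.inj hn
    rw [mul_assoc]
    by_cases hfe : f = e
    · rw [hfe, gho_mul_arr_self]
      rcases h.mul_vtx (G.r e) with h' | h'
      · exact Or.inl (by rwa [h'])
      · exact Or.inr h'
    · exact Or.inr (by rw [gho_mul_arr_of_ne G R hfe, mul_zero])

variable (G R)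

theorem mul_mem_span_of_forall {s t : Set (G.LeavittPathAlgebra R)} {y : G.LeavittPathAlgebra R}
    (h : ∀ x ∈ s, y * x ∈ Submodule.span R t) {x : G.LeavittPathAlgebra R}
    (hx : x ∈ Submodule.span R s) : y * x ∈ Submodule.span R t := by
  induction hx using Submodule.span_induction with
  | mem x hx => exact h x hx
  | zero => rw [mul_zero]; exact zero_mem _
  | add x z _ _ hx hz => rw [mul_add]; exact add_mem hx hz
  | smul k x _ hx => rw [mul_smul_comm]; exact Submodule.smul_mem _ _ hx

/-- The monomials. -/
def monomials : Set (G.LeavittPathAlgebra R) := {x | ∃ m n, IsMonomial G R m n x}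

theorem mk_gen_mul_mem_span_monomials (g : Generator V E) {x : G.LeavittPathAlgebra R}
    (hx : x ∈ Submodule.span R (monomials G R)) :
    mk G R (gen R g) * x ∈ Submodule.span R (monomials G R) := by
  refine mul_mem_span_of_forall G R ?_ hx
  rintro x ⟨m, n, h⟩
  cases g with
  | vertex a =>
    change vtx G R a * x ∈ _
    rcases h.vtx_mul a with h' | h' <;> rw [h']
    · exact Submodule.subset_span ⟨m, n, h⟩
    · exact zero_mem _
  | edge e => exact Submodule.subset_span ⟨m + 1, n, .arr_mul e h⟩
  | ghost e =>
    change gho G R e * x ∈ _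
    cases m with
    | zero =>
      rcases h.gho_mul_zero rfl e with h' | h'
      · exact Submodule.subset_span ⟨_, _, h'⟩
      · rw [h']; exact zero_mem _
    | succ m =>
      rcases h.gho_mul_succ e with h' | h'
      · exact Submodule.subset_span ⟨_, _, h'⟩
      · rw [h']; exact zero_mem _

theorem mk_gen_mem_span_monomials (g : Generator V E) :
    mk G R (gen R g) ∈ Submodule.span R (monomials G R) := by
  refine Submodule.subset_span ?_
  cases g with
  | vertex a => exact ⟨0, 0, .vertex a⟩
  | edge e =>
    refine ⟨1, 0, ?_⟩
    change IsMonomial G R 1 0 (arr G R e)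
    rw [← arr_mul_vtx_range]
    exact .arr_mul e (.vertex _)
  | ghost e =>
    refine ⟨0, 1, ?_⟩
    change IsMonomial G R 0 1 (gho G R e)
    rw [← vtx_range_mul_gho]
    exact .mul_gho e (.vertex _)

/-- Words are built by prepending generators, and left multiplication by a generator preserves the
span of the monomials. -/
theorem span_monomials : Submodule.span R (monomials G R) = ⊤ := by
  rw [eq_top_iff]
  rintro x -
  obtain ⟨x, rfl⟩ := mk_surjective G R x
  induction x using MonoidAlgebra.induction_linear with
  | zero => exact zero_mem _
  | add x y hx hy => rw [mk_add]; exact add_mem hx hy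
  | single w k =>
    have hw : (MonoidAlgebra.single w k : FreeAlg R V E) = k • MonoidAlgebra.single w 1 := by
      rw [MonoidAlgebra.smul_single', mul_one]
    rw [hw, mk_smul]
    refine Submodule.smul_mem _ _ ?_
    induction w using FreeSemigroup.recOnMul with
    | ih1 g => exact mk_gen_mem_span_monomials G R g
    | ih2 g w _ ih =>
      have hgw : (MonoidAlgebra.single (FreeSemigroup.of g * w) 1 : FreeAlg R V E) =
          gen R g * MonoidAlgebra.single w 1 := by
        rw [gen, MonoidAlgebra.single_mul_single, mul_one]
      rw [hgw, mk_mul]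
      exact mk_gen_mul_mem_span_monomials G R g (ih (by rw [MonoidAlgebra.smul_single', mul_one]))

end Monomials

/-! ### The grading, encoded by a coaction of Laurent polynomials -/

section Gauge

open scoped TensorProduct LaurentPolynomial
open LaurentPolynomial (T)

section Coefficients

variable {R : Type w} [CommRing R] {A : Type u} [NonUnitalRing A] [Module R A]

variable (R A) in
/-- The coefficient of `T ^ n` of a Laurent polynomial with coefficients in `A`. -/
noncomputable def tensorCoeff (n : ℤ) : A ⊗[R] R[T;T⁻¹] →ₗ[R] A :=
  TensorProduct.lift
    { toFun a :=
        { toFun p := p.coeff n • a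
          map_add' p q := by simp [add_smul]
          map_smul' k p := by simp [mul_smul] }
      map_add' a b := by ext; simp
      map_smul' k a := LinearMap.ext fun p => smul_comm (p.coeff n) k a }

theorem tensorCoeff_tmul (n : ℤ) (a : A) (p : R[T;T⁻¹]) :
    tensorCoeff R A n (a ⊗ₜ p) = p.coeff n • a := rfl

theorem finite_support_tensorCoeff (w : A ⊗[R] R[T;T⁻¹]) :
    (fun n => tensorCoeff R A n w).HasFiniteSupport := by
  induction w with
  | zero => simp [Function.HasFiniteSupport]
  | add x y hx hy =>
    simp only [map_add]
    exact hx.add hy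
  | tmul b p =>
    refine p.coeff.hasFiniteSupport.subset fun n hn => ?_
    contrapose! hn
    simp_all [tensorCoeff_tmul]

variable [IsScalarTower R A A] [SMulCommClass R A A]

theorem tensorCoeff_add_mul_tmul (n m : ℤ) (w : A ⊗[R] R[T;T⁻¹]) (a : A) :
    tensorCoeff R A (n + m) (w * a ⊗ₜ T m) = tensorCoeff R A n w * a := by
  induction w with
  | zero => simp
  | add x y hx hy => simp [add_mul, hx, hy]
  | tmul b p =>
    rw [Algebra.TensorProduct.tmul_mul_tmul, tensorCoeff_tmul, tensorCoeff_tmul, smul_mul_assoc]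
    congr 1
    simpa using AddMonoidAlgebra.coeff_mul_single_add p 1 m n

theorem tensorCoeff_add_tmul_mul (n m : ℤ) (w : A ⊗[R] R[T;T⁻¹]) (a : A) :
    tensorCoeff R A (n + m) (a ⊗ₜ T m * w) = a * tensorCoeff R A n w := by
  induction w with
  | zero => simp
  | add x y hx hy => simp [mul_add, hx, hy]
  | tmul b p =>
    rw [Algebra.TensorProduct.tmul_mul_tmul, tensorCoeff_tmul, tensorCoeff_tmul, mul_smul_comm]
    congr 1
    rw [mul_comm]
    simpa using AddMonoidAlgebra.coeff_mul_single_add p 1 m n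

end Coefficients

variable {V : Type u} {E : Type v} (G : DirectedGraph V E) (R : Type w) [CommRing R]

/-- The image of a generator under the gauge coaction. -/
noncomputable def gaugeGen : Generator V E → G.LeavittPathAlgebra R ⊗[R] R[T;T⁻¹]
  | .vertex a => vtx G R a ⊗ₜ T 0
  | .edge e => arr G R e ⊗ₜ T 1
  | .ghost e => gho G R e ⊗ₜ T (-1)

/-- The gauge coaction on the free algebra. -/
noncomputable def freeGauge : FreeAlg R V E →ₙₐ[R] G.LeavittPathAlgebra R ⊗[R] R[T;T⁻¹] :=
  MonoidAlgebra.liftMagma R (FreeSemigroup.lift (gaugeGen G R))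

theorem freeGauge_gen (g : Generator V E) : freeGauge G R (gen R g) = gaugeGen G R g := by
  simp [freeGauge, gen]

theorem freeGauge_vert (a : V) : freeGauge G R (vert R a) = vtx G R a ⊗ₜ T 0 :=
  freeGauge_gen G R _

theorem freeGauge_edge (e : E) : freeGauge G R (edge R e) = arr G R e ⊗ₜ T 1 :=
  freeGauge_gen G R _

theorem freeGauge_ghost (e : E) : freeGauge G R (ghost R e) = gho G R e ⊗ₜ T (-1) :=
  freeGauge_gen G R _

theorem freeGauge_eq_of_rel {x y : FreeAlg R V E} (h : G.Rel R x y) :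
    freeGauge G R x = freeGauge G R y := by
  cases h with
  | vert_mul_self a =>
    simp only [map_mul, freeGauge_vert,
      Algebra.TensorProduct.tmul_mul_tmul, ← LaurentPolynomial.T_add, vtx_mul_self, add_zero]
  | vert_mul_of_ne a b h =>
    simp only [map_mul, freeGauge_vert,
      Algebra.TensorProduct.tmul_mul_tmul, vtx_mul_of_ne G R h, map_zero,
      TensorProduct.zero_tmul]
  | source_mul_edge e =>
    simp only [map_mul, freeGauge_vert, freeGauge_edge,
      Algebra.TensorProduct.tmul_mul_tmul, ← LaurentPolynomial.T_add, vtx_source_mul_arr, zero_add]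
  | edge_mul_range e =>
    simp only [map_mul, freeGauge_vert, freeGauge_edge,
      Algebra.TensorProduct.tmul_mul_tmul, ← LaurentPolynomial.T_add, arr_mul_vtx_range, add_zero]
  | range_mul_ghost e =>
    simp only [map_mul, freeGauge_vert, freeGauge_ghost,
      Algebra.TensorProduct.tmul_mul_tmul, ← LaurentPolynomial.T_add, vtx_range_mul_gho, zero_add]
  | ghost_mul_source e =>
    simp only [map_mul, freeGauge_vert, freeGauge_ghost,
      Algebra.TensorProduct.tmul_mul_tmul, ← LaurentPolynomial.T_add, gho_mul_vtx_source, add_zero]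
  | ghost_mul_edge_self e =>
    simp only [map_mul, freeGauge_vert, freeGauge_edge, freeGauge_ghost,
      Algebra.TensorProduct.tmul_mul_tmul, ← LaurentPolynomial.T_add, gho_mul_arr_self,
      neg_add_cancel]
  | ghost_mul_edge_of_ne e f h =>
    simp only [map_mul, freeGauge_edge, freeGauge_ghost,
      Algebra.TensorProduct.tmul_mul_tmul, gho_mul_arr_of_ne G R h, map_zero,
      TensorProduct.zero_tmul]
  | cuntz_krieger a hfin hne =>
    -- Each ee* has degree 1 - 1 = 0, so the common factor `T 0` can be taken out of the sum.
    have h := mk_eq_of_rel G R (Rel.cuntz_krieger a hfin hne)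
    have hsum : vtx G R a = ∑ e ∈ hfin.toFinset, arr G R e * gho G R e :=
      h.trans (map_sum (AddMonoidHom.mk' (mk G R) (mk_add G R)) _ _)
    simp only [map_sum, map_mul, freeGauge_vert, freeGauge_edge, freeGauge_ghost,
      Algebra.TensorProduct.tmul_mul_tmul, ← LaurentPolynomial.T_add, add_neg_cancel]
    rw [hsum, TensorProduct.sum_tmul]

theorem freeGauge_eq_of_leavittCon {x y : FreeAlg R V E} (h : G.leavittCon R x y) :
    freeGauge G R x = freeGauge G R y := by
  change RingConGen.Rel _ x y at h
  induction h with
  | of x y h =>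
    obtain ⟨k, x, y, h, rfl, rfl⟩ := h
    rw [map_smul, map_smul, freeGauge_eq_of_rel G R h]
  | refl => rfl
  | symm _ ih => exact ih.symm
  | trans _ _ ih₁ ih₂ => exact ih₁.trans ih₂
  | add _ _ ih₁ ih₂ => rw [map_add, map_add, ih₁, ih₂]
  | mul _ _ ih₁ ih₂ => rw [map_mul, map_mul, ih₁, ih₂]

/-- The gauge coaction of the Leavitt path algebra, which sends `x` of degree `n` to
`x ⊗ T ^ n`. -/
noncomputable def gauge :
    G.LeavittPathAlgebra R →ₙₐ[R] G.LeavittPathAlgebra R ⊗[R] R[T;T⁻¹] where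
  toFun := Quotient.lift (freeGauge G R) fun _ _ => freeGauge_eq_of_leavittCon G R
  map_smul' k x := by
    obtain ⟨x, rfl⟩ := mk_surjective G R x
    exact map_smul (freeGauge G R) k x
  map_zero' := map_zero (freeGauge G R)
  map_add' x y := by
    obtain ⟨x, rfl⟩ := mk_surjective G R x
    obtain ⟨y, rfl⟩ := mk_surjective G R y
    exact map_add (freeGauge G R) x y
  map_mul' x y := by
    obtain ⟨x, rfl⟩ := mk_surjective G R x
    obtain ⟨y, rfl⟩ := mk_surjective G R y
    exact map_mul (freeGauge G R) x y

theorem gauge_vtx (a : V) : gauge G R (vtx G R a) = vtx G R a ⊗ₜ T 0 := freeGauge_vert G R a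

theorem gauge_arr (e : E) : gauge G R (arr G R e) = arr G R e ⊗ₜ T 1 := freeGauge_edge G R e

theorem gauge_gho (e : E) : gauge G R (gho G R e) = gho G R e ⊗ₜ T (-1) := freeGauge_ghost G R e

theorem IsMonomial.gauge_eq {G : DirectedGraph V E} {R : Type w} [CommRing R] {m n : ℕ}
    {x : G.LeavittPathAlgebra R} (h : IsMonomial G R m n x) :
    gauge G R x = x ⊗ₜ T (m - n : ℤ) := by
  induction h with
  | vertex a => exact gauge_vtx G R a
  | arr_mul e h ih =>
    rw [map_mul, ih, gauge_arr, Algebra.TensorProduct.tmul_mul_tmul, ← LaurentPolynomial.T_add]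
    congr 2
    push_cast; ring
  | mul_gho e h ih =>
    rw [map_mul, ih, gauge_gho, Algebra.TensorProduct.tmul_mul_tmul, ← LaurentPolynomial.T_add]
    congr 2
    push_cast; ring

/-- The homogeneous component of degree `n` of an element of the Leavitt path algebra. -/
noncomputable def component (n : ℤ) : G.LeavittPathAlgebra R →ₗ[R] G.LeavittPathAlgebra R :=
  tensorCoeff R (G.LeavittPathAlgebra R) n ∘ₗ (gauge G R : G.LeavittPathAlgebra R →ₗ[R] _)

theorem component_apply (n : ℤ) (x : G.LeavittPathAlgebra R) :
    component G R n x = tensorCoeff R _ n (gauge G R x) := rfl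

theorem finite_support_component (x : G.LeavittPathAlgebra R) :
    (fun n => component G R n x).HasFiniteSupport :=
  finite_support_tensorCoeff _

variable {G R}

theorem component_of_gauge_eq {m : ℤ} {x : G.LeavittPathAlgebra R}
    (h : gauge G R x = x ⊗ₜ T m) (n : ℤ) : component G R n x = if m = n then x else 0 := by
  rw [component_apply, h, tensorCoeff_tmul, LaurentPolynomial.T_apply, ite_smul, one_smul,
    zero_smul]

theorem component_add_mul {m : ℤ} {x : G.LeavittPathAlgebra R}
    (h : gauge G R x = x ⊗ₜ T m) (n : ℤ) (y : G.LeavittPathAlgebra R) :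
    component G R (n + m) (y * x) = component G R n y * x := by
  rw [component_apply, map_mul, h, tensorCoeff_add_mul_tmul, component_apply]

theorem component_add_mul' {m : ℤ} {x : G.LeavittPathAlgebra R}
    (h : gauge G R x = x ⊗ₜ T m) (n : ℤ) (y : G.LeavittPathAlgebra R) :
    component G R (n + m) (x * y) = x * component G R n y := by
  rw [component_apply, map_mul, h, tensorCoeff_add_tmul_mul, component_apply]

theorem mem_span_monomials (x : G.LeavittPathAlgebra R) :
    x ∈ Submodule.span R (monomials G R) := by
  rw [span_monomials]; trivial

theorem gauge_component (n : ℤ) (x : G.LeavittPathAlgebra R) :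
    gauge G R (component G R n x) = component G R n x ⊗ₜ T n := by
  induction mem_span_monomials x using Submodule.span_induction with
  | mem x hx =>
    obtain ⟨p, q, h⟩ := hx
    rw [component_of_gauge_eq h.gauge_eq]
    split_ifs with hn
    · rw [← hn, h.gauge_eq]
    · rw [map_zero, TensorProduct.zero_tmul]
  | zero => rw [map_zero, map_zero, TensorProduct.zero_tmul]
  | add x y _ _ hx hy => rw [map_add, map_add, hx, hy, TensorProduct.add_tmul]
  | smul k x _ hx => rw [map_smul, map_smul, hx, TensorProduct.smul_tmul']

theorem finsum_component (x : G.LeavittPathAlgebra R) : ∑ᶠ n, component G R n x = x := by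
  induction mem_span_monomials x using Submodule.span_induction with
  | mem x hx =>
    obtain ⟨p, q, h⟩ := hx
    rw [finsum_eq_single _ (p - q : ℤ) fun n hn => by
      rw [component_of_gauge_eq h.gauge_eq, if_neg hn.symm], component_of_gauge_eq h.gauge_eq,
      if_pos rfl]
  | zero => simp
  | add x y _ _ hx hy =>
    simp only [map_add]
    rw [finsum_add_distrib (finite_support_component G R x) (finite_support_component G R y),
      hx, hy]
  | smul k x _ hx =>
    simp only [map_smul]
    rw [← smul_finsum' k (finite_support_component G R x), hx]

/-- A monomial has degree m - n, so taking the component of degree zero keeps exactly those with m =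
n. -/
theorem component_zero_mem_span (x : G.LeavittPathAlgebra R) :
    component G R 0 x ∈ Submodule.span R {y | ∃ n, IsMonomial G R n n y} := by
  induction mem_span_monomials x using Submodule.span_induction with
  | mem x hx =>
    obtain ⟨p, q, h⟩ := hx
    rw [component_of_gauge_eq h.gauge_eq]
    split_ifs with hn
    · obtain rfl : p = q := by omega
      exact Submodule.subset_span ⟨p, h⟩
    · exact zero_mem _
  | zero => rw [map_zero]; exact zero_mem _
  | add x y _ _ hx hy => rw [map_add]; exact add_mem hx hy
  | smul k x _ hx => rw [map_smul]; exact Submodule.smul_mem _ _ hx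

end Gauge

/-! ### Corners of simple rings -/

section SimpleRing

variable {A : Type u} [NonUnitalRing A]

theorem mem_of_simple [IsSimpleRing A] {z : A} (I : TwoSidedIdeal A) (hz : z ∈ I) (hz0 : z ≠ 0)
    (x : A) : x ∈ I := by
  rcases eq_bot_or_eq_top I with h | h
  · rw [h] at hz
    exact absurd hz hz0
  · rw [h]
    trivial

/-- A nonzero element of the center of a corner of a simple ring is invertible in the corner. -/
theorem exists_mul_eq_of_simple [IsSimpleRing A] {v z : A} (hv : v * v = v) (hvz : v * z = z)
    (hz : ∀ x, z * (v * x * v) = v * x * v * z) (hz0 : z ≠ 0) :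
    ∃ u, z * u = v := by
  -- Sandwiching with arbitrary a and b makes this an ideal of the whole ring, although the
  -- condition only concerns the corner. Centrality puts z in it; membership of v, read at a = b =
  -- v, gives the inverse.
  let I : TwoSidedIdeal A := TwoSidedIdeal.mk' {x | ∀ a b, ∃ u, v * a * x * b * v = z * u}
    (fun a b => ⟨0, by simp⟩)
    (fun {x y} hx hy a b => by
      obtain ⟨p, hp⟩ := hx a b
      obtain ⟨q, hq⟩ := hy a b
      exact ⟨p + q, by rw [mul_add z, ← hp, ← hq]; simp only [mul_add, add_mul]⟩)
    (fun {x} hx a b => by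
      obtain ⟨p, hp⟩ := hx a b
      exact ⟨-p, by rw [mul_neg z, ← hp]; simp only [mul_neg, neg_mul]⟩)
    (fun {x y} hy a b => by
      obtain ⟨p, hp⟩ := hy (a * x) b
      exact ⟨p, by rw [← hp]; simp only [mul_assoc]⟩)
    (fun {x y} hx a b => by
      obtain ⟨p, hp⟩ := hx a (y * b)
      exact ⟨p, by rw [← hp]; simp only [mul_assoc]⟩)
  have hzI : z ∈ I := by
    rw [TwoSidedIdeal.mem_mk']
    intro a b
    refine ⟨v * a * v * b * v, ?_⟩
    calc v * a * z * b * v = v * a * v * z * b * v := by rw [mul_assoc (v * a) v z, hvz]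
      _ = z * (v * a * v) * b * v := by rw [hz]
      _ = z * (v * a * v * b * v) := by simp only [mul_assoc]
  have hvI := mem_of_simple I hzI hz0 v
  rw [TwoSidedIdeal.mem_mk'] at hvI
  obtain ⟨u, hu⟩ := hvI v v
  exact ⟨u, by rw [← hu]; simp only [hv]⟩

end SimpleRing

/-! ### Centralizers of a simple Leavitt path algebra -/

section Simple

variable {V : Type u} {E : Type v} {G : DirectedGraph V E} {K : Type w} [Field K]

/-- In a simple Leavitt path algebra, the center of the corner at a vertex lies in degree zero. -/
theorem component_eq_zero_of_simple [IsSimpleRing (G.LeavittPathAlgebra K)] {a : V}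
    {z : G.LeavittPathAlgebra K} (hvz : vtx G K a * z = z) (hzv : z * vtx G K a = z)
    (hz : ∀ x, z * (vtx G K a * x * vtx G K a) = vtx G K a * x * vtx G K a * z)
    {n : ℤ} (hn : n ≠ 0) : component G K n z = 0 := by
  by_contra hc
  set v := vtx G K a with hv
  set c := component G K n z with hcdef
  have hvv : v * v = v := vtx_mul_self G K a
  have hgv : gauge G K v = v ⊗ₜ LaurentPolynomial.T 0 := gauge_vtx G K a
  have hgc : gauge G K c = c ⊗ₜ LaurentPolynomial.T n := gauge_component n z
  have hvc : v * c = c := by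
    rw [hcdef, ← component_add_mul' hgv, add_zero, hvz]
  have hcv : c * v = c := by
    rw [hcdef, ← component_add_mul hgv, add_zero, hzv]
  -- Against a homogeneous element of the corner, centrality of z can be compared degree by degree,
  -- and monomials span.
  have hcomm : ∀ x, c * (v * x * v) = v * x * v * c := by
    intro x
    induction mem_span_monomials x using Submodule.span_induction with
    | mem x hx =>
      obtain ⟨p, q, h⟩ := hx
      have hg : gauge G K (v * x * v) = (v * x * v) ⊗ₜ LaurentPolynomial.T (p - q : ℤ) := by
        rw [map_mul, map_mul, hgv, h.gauge_eq, Algebra.TensorProduct.tmul_mul_tmul,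
          Algebra.TensorProduct.tmul_mul_tmul, LaurentPolynomial.T_zero, one_mul, mul_one]
      rw [hcdef, ← component_add_mul hg, ← component_add_mul' hg, hz]
    | zero => simp
    | add x y _ _ hx hy => simp only [mul_add, add_mul, hx, hy]
    | smul k x _ hx => simp only [mul_smul_comm, smul_mul_assoc, hx]
  have hv0 : v ≠ 0 := fun h => hc (by rw [← hvc, h, zero_mul])
  obtain ⟨u, hu⟩ := exists_mul_eq_of_simple hvv hvc hcomm hc
  -- Since c is central in the corner, its right inverse is also a left inverse once compressed to
  -- vuv.
  have hinj : ∀ x, v * x = x → c * x = 0 → x = 0 := by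
    intro x hx hcx
    have hu' : v * u * v * c = v := by
      rw [← hcomm, ← mul_assoc, ← mul_assoc, hcv, hu, hvv]
    rw [← hx, ← hu', mul_assoc, hcx, mul_zero]
  have hsum : v + c ≠ 0 := by
    intro h
    have := congrArg (component G K 0) h
    rw [map_add, map_zero, component_of_gauge_eq hgv, component_of_gauge_eq hgc, if_pos rfl,
      if_neg hn, add_zero] at this
    exact hv0 this
  obtain ⟨y, hy⟩ := exists_mul_eq_of_simple hvv (z := v + c) (by rw [mul_add, hvv, hvc]) (fun x => by
      rw [add_mul, mul_add, hcomm]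
      congr 1
      simp only [mul_assoc, hvv]
      simp only [← mul_assoc, hvv]) hsum
  set t : ℤ → G.LeavittPathAlgebra K := fun m => component G K m (v * y) with ht
  have hvt : ∀ m, v * t m = t m := by
    intro m
    rw [ht]
    simp only
    rw [← component_add_mul' hgv, add_zero, ← mul_assoc, hvv]
  -- This is the part of degree m + n of (v + c)(vy) = v.
  have hrec : ∀ m, t (m + n) + c * t m = if m + n = 0 then v else 0 := by
    intro m
    have h : v * y + c * (v * y) = v := by rw [← mul_assoc, hcv, ← add_mul, hy]
    have := congrArg (component G K (m + n)) h
    rw [map_add, component_add_mul' hgc, component_of_gauge_eq hgv] at this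
    simpa only [eq_comm (a := (0 : ℤ))] using this
  have hstep : ∀ m, m + n ≠ 0 → (t (m + n) = 0 ↔ t m = 0) := by
    intro m hm
    have := hrec m
    rw [if_neg hm] at this
    constructor
    · intro h
      rw [h, zero_add] at this
      exact hinj _ (hvt m) this
    · intro h
      rwa [h, mul_zero, add_zero] at this
  have hfin : ∀ f : ℕ → ℤ, Function.Injective f → ∃ k, t (f k) = 0 := by
    intro f hf
    by_contra! h
    exact Set.infinite_of_injective_forall_mem hf (s := Function.support t) h
      (finite_support_component G K (v * y))
  -- Along 0, n, 2n, ... some component vanishes by finiteness. Vanishing propagates back to 0,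
  -- since no step lands in degree 0, the only exception in `hstep`.
  have h0 : t 0 = 0 := by
    obtain ⟨k, hk⟩ := hfin (fun k => k * n) fun i j hij => by
      simpa [hn] using hij
    induction k with
    | zero => simpa using hk
    | succ k ih =>
      refine ih ((hstep _ ?_).1 ?_)
      · have : (k : ℤ) + 1 ≠ 0 := by positivity
        rw [show (k : ℤ) * n + n = (k + 1) * n by ring]
        exact mul_ne_zero this hn
      · rw [← hk]; congr 1; push_cast; ring
  -- The same in the other direction along -n, -2n, ...; the excluded step from -n to 0 is not used.
  have h1 : t (-n) = 0 := by
    obtain ⟨k, hk⟩ := hfin (fun k => -n - k * n) fun i j hij => by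
      simpa [hn] using hij
    induction k with
    | zero => simpa using hk
    | succ k ih =>
      refine ih ?_
      have hk' := (hstep (-n - (k + 1 : ℕ) * n) ?_).2 hk
      · rw [← hk']; congr 1; push_cast; ring
      · have : (k : ℤ) + 1 ≠ 0 := by positivity
        rw [show -n - ((k + 1 : ℕ) : ℤ) * n + n = -((k + 1) * n) by push_cast; ring]
        exact neg_ne_zero.2 (mul_ne_zero this hn)
  -- The excluded step now reads 0 + c · 0 = v.
  have := hrec (-n)
  rw [neg_add_cancel, if_pos rfl, h0, h1, mul_zero, add_zero] at this
  exact hv0 this.symm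

theorem vtx_mul_centralizer {τ : Module.End K (G.LeavittPathAlgebra K)}
    (hτ : τ ∈ centroid K (G.LeavittPathAlgebra K)) (a : V) :
    vtx G K a * τ (vtx G K a) = τ (vtx G K a) := by
  rw [← (hτ _ _).2, vtx_mul_self]

theorem centralizer_mul_vtx {τ : Module.End K (G.LeavittPathAlgebra K)}
    (hτ : τ ∈ centroid K (G.LeavittPathAlgebra K)) (a : V) :
    τ (vtx G K a) * vtx G K a = τ (vtx G K a) := by
  rw [← (hτ _ _).1, vtx_mul_self]

/-- Both τ(a)(axa) and (axa)τ(a) equal τ(axa), so τ(a) is central in the corner and has no component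
outside degree zero. -/
theorem centralizer_vtx_eq_component [IsSimpleRing (G.LeavittPathAlgebra K)]
    {τ : Module.End K (G.LeavittPathAlgebra K)}
    (hτ : τ ∈ centroid K (G.LeavittPathAlgebra K)) (a : V) :
    component G K 0 (τ (vtx G K a)) = τ (vtx G K a) := by
  have h := finsum_component (τ (vtx G K a))
  rwa [finsum_eq_single _ (0 : ℤ) fun n hn =>
    component_eq_zero_of_simple (vtx_mul_centralizer hτ a) (centralizer_mul_vtx hτ a) (fun x => by
      rw [← (hτ _ _).1, ← (hτ _ _).2]
      simp only [mul_assoc, vtx_mul_self]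
      simp only [← mul_assoc, vtx_mul_self]) hn] at h

/-! ### Descent on the length of balanced monomials -/

variable (G K) in
/-- The monomials with the same number `n < N` of real and of ghost edges. -/
def balancedMonomials (N : ℕ) : Set (G.LeavittPathAlgebra K) :=
  {x | ∃ n < N, IsMonomial G K n n x}

theorem span_balancedMonomials_mono {M N : ℕ} (h : M ≤ N) :
    Submodule.span K (balancedMonomials G K M) ≤ Submodule.span K (balancedMonomials G K N) :=
  Submodule.span_mono fun _ ⟨n, hn, hy⟩ => ⟨n, hn.trans_le h, hy⟩

theorem exists_mem_span_balancedMonomials {x : G.LeavittPathAlgebra K}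
    (hx : x ∈ Submodule.span K {y | ∃ n, IsMonomial G K n n y}) :
    ∃ N, x ∈ Submodule.span K (balancedMonomials G K N) := by
  induction hx using Submodule.span_induction with
  | mem x hx =>
    obtain ⟨n, h⟩ := hx
    exact ⟨n + 1, Submodule.subset_span ⟨n, n.lt_succ_self, h⟩⟩
  | zero => exact ⟨0, zero_mem _⟩
  | add x y _ _ hx hy =>
    obtain ⟨M, hM⟩ := hx
    obtain ⟨N, hN⟩ := hy
    exact ⟨max M N, add_mem (span_balancedMonomials_mono (le_max_left M N) hM)
      (span_balancedMonomials_mono (le_max_right M N) hN)⟩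
  | smul k x _ hx =>
    obtain ⟨N, hN⟩ := hx
    exact ⟨N, Submodule.smul_mem _ _ hN⟩

/-- Conjugation strips one real edge from the left and one ghost edge from the right. A vertex has
none to lose and becomes r(e) or 0, hence the need for `0 < N`. -/
theorem gho_mul_mul_arr_mem_span {N : ℕ} (hN : 0 < N) (e : E) {x : G.LeavittPathAlgebra K}
    (hx : x ∈ Submodule.span K (balancedMonomials G K (N + 1))) :
    gho G K e * x * arr G K e ∈ Submodule.span K (balancedMonomials G K N) := by
  induction hx using Submodule.span_induction with
  | mem x hx =>
    obtain ⟨n, hn, h⟩ := hx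
    cases n with
    | zero =>
      have hx : x * arr G K e = arr G K e ∨ x * arr G K e = 0 := by
        obtain ⟨b⟩ | _ | _ := h
        by_cases hb : b = G.s e
        · exact Or.inl (by rw [hb, vtx_source_mul_arr])
        · exact Or.inr (vtx_mul_arr_of_ne G K hb)
      rw [mul_assoc]
      rcases hx with hx | hx <;> rw [hx]
      · rw [gho_mul_arr_self]
        exact Submodule.subset_span ⟨0, hN, .vertex _⟩
      · rw [mul_zero]; exact zero_mem _
    | succ n =>
      rcases h.gho_mul_succ e with h' | h'
      · rcases h'.mul_arr e with h' | h'
        · exact Submodule.subset_span ⟨n, by omega, h'⟩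
        · rw [h']; exact zero_mem _
      · rw [h', zero_mul]; exact zero_mem _
  | zero => simp
  | add x y _ _ hx hy => simp only [mul_add, add_mul]; exact add_mem hx hy
  | smul k x _ hx =>
    simp only [mul_smul_comm, smul_mul_assoc]
    exact Submodule.smul_mem _ _ hx

/-- The corner at a vertex `a` is spanned in degree zero by `a` if no nonzero edge starts at `a`
or if only monomials without edges are involved. -/
theorem vtx_mul_mul_vtx_eq_smul {N : ℕ} {a : V}
    (h : N = 1 ∨ ∀ e, vtx G K a * arr G K e = 0) {x : G.LeavittPathAlgebra K}
    (hx : x ∈ Submodule.span K (balancedMonomials G K N)) :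
    ∃ k : K, vtx G K a * x * vtx G K a = k • vtx G K a := by
  induction hx using Submodule.span_induction with
  | mem x hx =>
    obtain ⟨n, hn, hx⟩ := hx
    cases n with
    | zero =>
      obtain ⟨b⟩ | _ | _ := hx
      by_cases hb : a = b
      · exact ⟨1, by rw [hb, vtx_mul_self, vtx_mul_self, one_smul]⟩
      · exact ⟨0, by rw [vtx_mul_of_ne G K hb, zero_mul, zero_smul]⟩
    | succ n =>
      rcases h with h | h
      · omega
      · obtain _ | ⟨e, hx⟩ | _ := hx
        exact ⟨0, by rw [← mul_assoc, h, zero_mul, zero_mul, zero_smul]⟩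
  | zero => exact ⟨0, by simp⟩
  | add x y _ _ hx hy =>
    obtain ⟨k, hk⟩ := hx
    obtain ⟨l, hl⟩ := hy
    exact ⟨k + l, by rw [mul_add, add_mul, hk, hl, add_smul]⟩
  | smul k x _ hx =>
    obtain ⟨l, hl⟩ := hx
    exact ⟨k * l, by rw [mul_smul_comm, smul_mul_assoc, hl, mul_smul]⟩

/-- Induction on the length bound, moving from a to the range of an edge leaving a. It stops when
only vertices remain in the bound or when no nonzero edge leaves the current vertex. -/
theorem exists_centralizer_vtx_eq_smul {τ : Module.End K (G.LeavittPathAlgebra K)}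
    (hτ : τ ∈ centroid K (G.LeavittPathAlgebra K)) (N : ℕ) (a : V) (ha : vtx G K a ≠ 0)
    (hN : τ (vtx G K a) ∈ Submodule.span K (balancedMonomials G K (N + 1))) :
    ∃ (b : V) (k : K), vtx G K b ≠ 0 ∧ τ (vtx G K b) = k • vtx G K b := by
  induction N generalizing a with
  | zero =>
    obtain ⟨k, hk⟩ := vtx_mul_mul_vtx_eq_smul (a := a) (Or.inl rfl) hN
    rw [vtx_mul_centralizer hτ, centralizer_mul_vtx hτ] at hk
    exact ⟨a, k, ha, hk⟩
  | succ N ih =>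
    by_cases h : ∀ e, vtx G K a * arr G K e = 0
    · obtain ⟨k, hk⟩ := vtx_mul_mul_vtx_eq_smul (Or.inr h) hN
      rw [vtx_mul_centralizer hτ, centralizer_mul_vtx hτ] at hk
      exact ⟨a, k, ha, hk⟩
    · push Not at h
      obtain ⟨e, he⟩ := h
      have hae : a = G.s e := by
        by_contra hne
        exact he (vtx_mul_arr_of_ne G K hne)
      subst hae
      -- The range is nonzero because e = e r(e), and e* τ(s(e)) e = τ(r(e)) satisfies the smaller
      -- bound.
      refine ih (G.r e) (fun h0 => he ?_) ?_
      · rw [← arr_mul_vtx_range, h0, mul_zero, mul_zero]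
      · have := gho_mul_mul_arr_mem_span N.succ_pos e hN
        rwa [← (hτ _ _).2, ← (hτ _ _).1, gho_mul_vtx_source, gho_mul_arr_self] at this

/-- Every monomial has a vertex as a factor, so if all vertices vanished, so would the span. -/
theorem exists_vtx_ne_zero [Nontrivial (G.LeavittPathAlgebra K)] : ∃ a, vtx G K a ≠ 0 := by
  by_contra! h
  have hm : ∀ {m n x}, IsMonomial G K m n x → x = 0 := by
    intro m n x hx
    induction hx with
    | vertex a => exact h a
    | arr_mul e _ ih => rw [ih, mul_zero]
    | mul_gho e _ ih => rw [ih, zero_mul]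
  obtain ⟨x, hx⟩ := exists_ne (0 : G.LeavittPathAlgebra K)
  have hspan : Submodule.span K (monomials G K) = ⊥ :=
    Submodule.span_eq_bot.2 fun y hy => by
      obtain ⟨_, _, hy⟩ := hy
      exact hm hy
  have := mem_span_monomials x
  rw [hspan] at this
  exact hx this

theorem exists_centralizer_eq_smul [IsSimpleRing (G.LeavittPathAlgebra K)]
    [Nontrivial (G.LeavittPathAlgebra K)] {τ : Module.End K (G.LeavittPathAlgebra K)}
    (hτ : τ ∈ centroid K (G.LeavittPathAlgebra K)) : ∃ k : K, ∀ x, τ x = k • x := by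
  obtain ⟨a, ha⟩ := exists_vtx_ne_zero (G := G) (K := K)
  have hspan := component_zero_mem_span (τ (vtx G K a))
  rw [centralizer_vtx_eq_component hτ] at hspan
  obtain ⟨N, hN⟩ := exists_mem_span_balancedMonomials hspan
  have hN' : τ (vtx G K a) ∈ Submodule.span K (balancedMonomials G K (N + 1)) :=
    span_balancedMonomials_mono N.le_succ hN
  obtain ⟨b, k, hb, hk⟩ := exists_centralizer_vtx_eq_smul hτ N a ha hN'
  -- One eigenvector suffices: the eigenspace is stable under multiplication on both sides because τ
  -- is a centralizer.
  let I : TwoSidedIdeal (G.LeavittPathAlgebra K) := TwoSidedIdeal.mk' {x | τ x = k • x}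
    (by simp)
    (fun {x y} (hx : τ x = k • x) (hy : τ y = k • y) => show τ (x + y) = k • (x + y) by
      rw [map_add, hx, hy, smul_add])
    (fun {x} (hx : τ x = k • x) => show τ (-x) = k • -x by rw [map_neg, hx, smul_neg])
    (fun {x y} (hy : τ y = k • y) => show τ (x * y) = k • (x * y) by
      rw [(hτ _ _).2, hy, mul_smul_comm])
    (fun {x y} (hx : τ x = k • x) => show τ (x * y) = k • (x * y) by
      rw [(hτ _ _).1, hx, smul_mul_assoc])
  have hbI : vtx G K b ∈ I := by
    rw [TwoSidedIdeal.mem_mk']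
    exact hk
  refine ⟨k, fun x => ?_⟩
  have := mem_of_simple I hbI hb x
  rwa [TwoSidedIdeal.mem_mk'] at this

end Simple

end LeavittPathAlgebra

end DirectedGraph

/-- The centroid of a simple Leavitt path algebra over a field `K` is isomorphic to `K`, and every
centralizer is a scalar multiple of the identity. -/
theorem proposition3 {V : Type u} {E : Type v} (G : DirectedGraph V E) (K : Type w) [Field K]
    (hsimple : IsSimpleRing (G.LeavittPathAlgebra K)) :
    Nonempty (centroid K (G.LeavittPathAlgebra K) ≃ₐ[K] K) ∧
      ∀ τ ∈ centroid K (G.LeavittPathAlgebra K), ∃ k : K, ∀ x, τ x = k • x := by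
  have hnt : Nontrivial (G.LeavittPathAlgebra K) := by
    by_contra h
    rw [not_nontrivial_iff_subsingleton] at h
    refine bot_ne_top (α := TwoSidedIdeal (G.LeavittPathAlgebra K)) (TwoSidedIdeal.ext fun x => ?_)
    rw [Subsingleton.elim x 0]
    exact ⟨fun _ => TwoSidedIdeal.zero_mem _, fun _ => TwoSidedIdeal.zero_mem _⟩
  have hscalar : ∀ τ ∈ centroid K (G.LeavittPathAlgebra K), ∃ k : K, ∀ x, τ x = k • x :=
    fun τ hτ => DirectedGraph.LeavittPathAlgebra.exists_centralizer_eq_smul hτ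
  -- A ring homomorphism from a field to a nontrivial ring is injective; surjectivity is `hscalar`.
  refine ⟨⟨(AlgEquiv.ofBijective (Algebra.ofId K (centroid K (G.LeavittPathAlgebra K)))
    ⟨RingHom.injective _, ?_⟩).symm⟩, hscalar⟩
  rintro ⟨τ, hτ⟩
  obtain ⟨k, hk⟩ := hscalar τ hτ
  exact ⟨k, Subtype.ext (LinearMap.ext fun x => (hk x).symm)⟩
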